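/- Let $N\ge 1$, let $\Omega\subset\mathbb R^N$ be a bounded domain (no regularity of $\partial\Omega$ is needed; in particular the boundary may be Lipschitz), and let $1<q<p<\infty$ with $N<p$. Let $g:\mathbb R\to[a_0,\infty)$ be continuous with $a_0>0$, and let $f:\Omega\times\mathbb R\times\mathbb R^N\to\mathbb R$ be a Carathéodory function ($f(\cdot,s,\xi)$ is measurable for all $(s,\xi)$, and $f(x,\cdot,\cdot)$ is continuous for a.e. $x\in\Omega$) such that: * there are $r_1,r_2\ge 1$, a nonnegative $\sigma\in L^{r_1}(\Omega)$ and constants $b,c\ge 0$ with $$|f(x,s,\xi)|\le\sigma(x)+b|s|^{r_2}+c|\xi|^{p-1}\quad\text{for a.e. }x\in\Omega\text{ and all }s\in\mathbb R,\ \xi\in\mathbb R^N;$$ * there are constants $c_0<a_0$, $c_1>0$ and $\alpha\in[1,p)$ with $$f(x,s,\xi)\,s\le c_0|\xi|^p+c_1(|s|^\alpha+1)\quad\text{for a.e. }x\in\Omega\text{ and all }s\in\mathbb R,\ \xi\in\mathbb R^N.$$ Let $W_0^{1,p}(\Omega)$ be the closure of $C_c^\infty(\Omega)$ in $W^{1,p}(\Omega)$,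 normed by $\|u\|_{W_0^{1,p}(\Omega)}=\|\nabla u\|_{L^p(\Omega)}$. A weak solution of $$-\operatorname{div}\big(g(u)|\nabla u|^{p-2}\nabla u\big)+\operatorname{div}\big(|\nabla u|^{q-2}\nabla u\big)=f(x,u,\nabla u)\ \text{ in }\Omega,\qquad u=0\ \text{ on }\partial\Omega,$$ is a function $u\in W_0^{1,p}(\Omega)$ such that, for every $v\in W_0^{1,p}(\Omega)$, $$\int_\Omega g(u)|\nabla u|^{p-2}\nabla u\cdot\nabla v\,dx-\int_\Omega|\nabla u|^{q-2}\nabla u\cdot\nabla v\,dx=\int_\Omega f(x,u,\nabla u)\,v\,dx.$$ Then there exist constants $R,R_1>0$ such that every weak solution $u$ satisfies $\|u\|_{W_0^{1,p}(\Omega)}\le R_1$ and $\|u\|_{C(\overline\Omega)}\le R$, where the latter means that $u$ has a representative that is continuous on $\overline\Omega$ and bounded there by $R$ in absolute value. -/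

import Mathlib

open MeasureTheory
open scoped ContDiff

/-- Test functions: `φ ∈ C_c^∞(Ω)`. -/
def IsTestFunction {N : ℕ} (Ω : Set (EuclideanSpace ℝ (Fin N)))
    (φ : EuclideanSpace ℝ (Fin N) → ℝ) : Prop :=
  ContDiff ℝ ∞ φ ∧ HasCompactSupport φ ∧ tsupport φ ⊆ Ω

/-- `Du` is the weak (distributional) gradient of `u` in `Ω`:
`∫_Ω u ∂ᵢφ dx = - ∫_Ω (Du)ᵢ φ dx` for every test function `φ` and every coordinate `i`. -/
def IsWeakGradient {N : ℕ} (Ω : Set (EuclideanSpace ℝ (Fin N)))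
    (u : EuclideanSpace ℝ (Fin N) → ℝ)
    (Du : EuclideanSpace ℝ (Fin N) → EuclideanSpace ℝ (Fin N)) : Prop :=
  ∀ φ : EuclideanSpace ℝ (Fin N) → ℝ, IsTestFunction Ω φ → ∀ i : Fin N,
    ∫ x in Ω, u x * fderiv ℝ φ x (EuclideanSpace.single i 1) = - ∫ x in Ω, Du x i * φ x

/-- `u ∈ W^{1,p}(Ω)` with weak gradient `Du` (unique up to a.e. equality on `Ω`). -/
structure MemSobolev {N : ℕ} (Ω : Set (EuclideanSpace ℝ (Fin N))) (p : ℝ)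
    (u : EuclideanSpace ℝ (Fin N) → ℝ)
    (Du : EuclideanSpace ℝ (Fin N) → EuclideanSpace ℝ (Fin N)) : Prop where
  memLp : MemLp u (ENNReal.ofReal p) (volume.restrict Ω)
  memLp_grad : MemLp Du (ENNReal.ofReal p) (volume.restrict Ω)
  weakGrad : IsWeakGradient Ω u Du

/-- `u ∈ W_0^{1,p}(Ω)` with weak gradient `Du`: the closure of `C_c^∞(Ω)` in `W^{1,p}(Ω)`. -/
structure MemSobolevZero {N : ℕ} (Ω : Set (EuclideanSpace ℝ (Fin N))) (p : ℝ)
    (u : EuclideanSpace ℝ (Fin N) → ℝ)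
    (Du : EuclideanSpace ℝ (Fin N) → EuclideanSpace ℝ (Fin N)) : Prop where
  memSobolev : MemSobolev Ω p u Du
  approx : ∀ ε : ℝ, 0 < ε → ∃ φ : EuclideanSpace ℝ (Fin N) → ℝ, IsTestFunction Ω φ ∧
    eLpNorm (fun x => u x - φ x) (ENNReal.ofReal p) (volume.restrict Ω) ≤ ENNReal.ofReal ε ∧
    eLpNorm (fun x => Du x - gradient φ x) (ENNReal.ofReal p) (volume.restrict Ω)
      ≤ ENNReal.ofReal ε

/-- The weight: `g : ℝ → [a₀, ∞)` is continuous and `a₀ > 0`. -/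
structure WeightCondition (a₀ : ℝ) (g : ℝ → ℝ) : Prop where
  pos : 0 < a₀
  continuous : Continuous g
  le : ∀ t, a₀ ≤ g t

/-- `f` is a Carathéodory function on `Ω × ℝ × ℝ^N`: (Lebesgue) measurable in `x`,
continuous in `(s, ξ)` for a.e. `x`. -/
structure IsCaratheodory {N : ℕ} (Ω : Set (EuclideanSpace ℝ (Fin N)))
    (f : EuclideanSpace ℝ (Fin N) → ℝ → EuclideanSpace ℝ (Fin N) → ℝ) : Prop where
  measurable : ∀ s ξ, AEMeasurable (fun x => f x s ξ) (volume.restrict Ω)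
  continuous : ∀ᵐ x ∂(volume.restrict Ω),
    Continuous (fun z : ℝ × EuclideanSpace ℝ (Fin N) => f x z.1 z.2)

/-- Growth: `|f(x,s,ξ)| ≤ σ(x) + b |s|^{r₂} + c |ξ|^{p-1}` with `0 ≤ σ ∈ L^{r₁}(Ω)`. -/
def GrowthCondition {N : ℕ} (Ω : Set (EuclideanSpace ℝ (Fin N))) (p : ℝ)
    (f : EuclideanSpace ℝ (Fin N) → ℝ → EuclideanSpace ℝ (Fin N) → ℝ) : Prop :=
  ∃ (σ : EuclideanSpace ℝ (Fin N) → ℝ) (b c r₁ r₂ : ℝ),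
    0 ≤ b ∧ 0 ≤ c ∧ 1 ≤ r₁ ∧ 1 ≤ r₂ ∧
    (∀ᵐ x ∂(volume.restrict Ω), 0 ≤ σ x) ∧
    MemLp σ (ENNReal.ofReal r₁) (volume.restrict Ω) ∧
    ∀ᵐ x ∂(volume.restrict Ω), ∀ (s : ℝ) (ξ : EuclideanSpace ℝ (Fin N)),
      |f x s ξ| ≤ σ x + b * |s| ^ r₂ + c * ‖ξ‖ ^ (p - 1)

/-- One-sided bound: `f(x,s,ξ) s ≤ c₀ |ξ|^p + c₁ (|s|^α + 1)` with `c₀ < a₀`, `c₁ > 0`,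
`1 ≤ α < p`. -/
def OneSidedCondition {N : ℕ} (Ω : Set (EuclideanSpace ℝ (Fin N))) (p a₀ : ℝ)
    (f : EuclideanSpace ℝ (Fin N) → ℝ → EuclideanSpace ℝ (Fin N) → ℝ) : Prop :=
  ∃ c₀ c₁ α : ℝ, c₀ < a₀ ∧ 0 < c₁ ∧ 1 ≤ α ∧ α < p ∧
    ∀ᵐ x ∂(volume.restrict Ω), ∀ (s : ℝ) (ξ : EuclideanSpace ℝ (Fin N)),
      f x s ξ * s ≤ c₀ * ‖ξ‖ ^ p + c₁ * (|s| ^ α + 1)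

/-- `u ∈ W_0^{1,p}(Ω)`, with weak gradient `Du`, is a weak solution of
`-div(g(u)|∇u|^{p-2}∇u) + div(|∇u|^{q-2}∇u) = f(x,u,∇u)` in `Ω`, `u = 0` on `∂Ω`. -/
structure IsWeakSolution {N : ℕ} (Ω : Set (EuclideanSpace ℝ (Fin N))) (p q : ℝ) (g : ℝ → ℝ)
    (f : EuclideanSpace ℝ (Fin N) → ℝ → EuclideanSpace ℝ (Fin N) → ℝ)
    (u : EuclideanSpace ℝ (Fin N) → ℝ)
    (Du : EuclideanSpace ℝ (Fin N) → EuclideanSpace ℝ (Fin N)) : Prop where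
  mem : MemSobolevZero Ω p u Du
  eq : ∀ (v : EuclideanSpace ℝ (Fin N) → ℝ)
    (Dv : EuclideanSpace ℝ (Fin N) → EuclideanSpace ℝ (Fin N)), MemSobolevZero Ω p v Dv →
    (∫ x in Ω, g (u x) * inner ℝ (‖Du x‖ ^ (p - 2) • Du x) (Dv x))
      - (∫ x in Ω, inner ℝ (‖Du x‖ ^ (q - 2) • Du x) (Dv x))
      = ∫ x in Ω, f x (u x) (Du x) * v x

/-! Test the equation with `u` itself and write `I` for the integral of `|∇u|^p`. The lower bound on
`g` and the one-sided bound on `f` give `(a₀ - c₀) I ≤ ∫ |∇u|^q + c₁ ∫ (|u|^α + 1)`. Since `q < p`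
and `α < p`, both right-hand powers are at most a small multiple of the `p`-th power plus a
constant. The sup-norm Morrey inequality turns `|u|^p` into a multiple of `I`, so everything of
order `I` is absorbed on the left. This bounds `I`, and Morrey again bounds `u` uniformly.

`exists_continuous_representative` carries this Morrey bound. It does double duty: boundedness of
`u` also makes `g(u)|∇u|^p` and `f(x,u,∇u)u` integrable, although `g` may be unbounded and `σ` may
be only in `L¹`. Boundary regularity plays no role because test functions extend by zero to the
whole space. -/

/-! ### Morrey's inequality in the sup norm -/

open Module Set in
lemma eLpNorm_comp_add_smul {E F : Type*} [NormedAddCommGroup E] [NormedSpace ℝ E]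
    [FiniteDimensional ℝ E] [MeasurableSpace E] [BorelSpace E] (μ : Measure E)
    [μ.IsAddHaarMeasure] [NormedAddCommGroup F] {G : E → F} (hG : AEStronglyMeasurable G μ)
    {p : ℝ} (hp : 0 < p) (x : E) {t : ℝ} (ht : 0 < t) :
    eLpNorm (fun z => G (x + t • z)) (ENNReal.ofReal p) μ
      = ENNReal.ofReal (t ^ (-(finrank ℝ E : ℝ) / p)) * eLpNorm G (ENNReal.ofReal p) μ := by
  have h1 : Measure.map (fun z => x + t • z) μ
      = ENNReal.ofReal (abs (t ^ finrank ℝ E)⁻¹) • μ := by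
    have h2 : Measure.map (fun z => x + z) (Measure.map (t • ·) μ)
        = Measure.map (fun z => x + t • z) μ :=
      Measure.map_map (measurable_const_add x) (measurable_const_smul t)
    rw [← h2, Measure.map_addHaar_smul μ ht.ne', Measure.map_smul, map_add_left_eq_self]
  have h3 := eLpNorm_map_measure (p := ENNReal.ofReal p) (μ := μ) (f := fun z => x + t • z)
    (g := G) (by rw [h1]; exact hG.smul_measure _) (by fun_prop)
  rw [h1] at h3
  change _ = eLpNorm (fun z => G (x + t • z)) _ _ at h3
  have h4 : (0 : ℝ) ≤ (t ^ finrank ℝ E)⁻¹ := by positivity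
  rw [← h3, eLpNorm_smul_measure_of_ne_top ENNReal.ofReal_ne_top, smul_eq_mul]
  congr 1
  rw [abs_of_nonneg h4, ENNReal.toReal_div, ENNReal.toReal_one,
    ENNReal.toReal_ofReal hp.le, ENNReal.ofReal_rpow_of_nonneg h4 (by positivity)]
  congr 1
  rw [← Real.rpow_natCast, ← Real.rpow_neg ht.le, ← Real.rpow_mul ht.le]
  ring_nf

open Module Set in
/-- Sup-norm form of Morrey's inequality: if `p` exceeds the dimension, a `C¹` function supported
in a fixed ball is bounded by the `Lᵖ` norm of its derivative. -/
theorem exists_enorm_le_mul_eLpNorm_fderiv {E : Type*} [NormedAddCommGroup E] [NormedSpace ℝ E]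
    [FiniteDimensional ℝ E] [Nontrivial E] [MeasurableSpace E] [BorelSpace E] (μ : Measure E)
    [μ.IsAddHaarMeasure] {p : ℝ} (hp : (finrank ℝ E : ℝ) < p) {D : ℝ} (hD : 0 ≤ D) :
    ∃ C : NNReal, ∀ φ : E → ℝ, ContDiff ℝ 1 φ → (∀ y, D < ‖y‖ → φ y = 0) →
      ∀ x, ‖φ x‖ₑ ≤ C * eLpNorm (fderiv ℝ φ) (ENNReal.ofReal p) μ := by
  have hd : (1 : ℝ) ≤ finrank ℝ E := by exact_mod_cast (finrank_pos : 0 < finrank ℝ E)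
  have hp0 : 0 < p := by linarith
  obtain ⟨e, he⟩ := exists_norm_eq E (zero_le_two (α := ℝ))
  -- A ball of directions away from the origin: every ray `x + t • z` with `z ∈ A` has speed between
  -- 1 and 3. Averaging over `z` replaces polar coordinates.
  set A : Set E := Metric.closedBall e 1 with hA
  have hA0 : μ A ≠ 0 := (Metric.measure_closedBall_pos μ e one_pos).ne'
  have hAt : μ A ≠ ⊤ := measure_closedBall_lt_top.ne
  have hz : ∀ z ∈ A, 1 ≤ ‖z‖ ∧ ‖z‖ ≤ 3 := by
    intro z hz
    rw [hA, mem_closedBall_iff_norm] at hz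
    have h1 := norm_sub_norm_le e z
    have h2 := norm_sub_norm_le z e
    rw [norm_sub_rev] at h1
    constructor <;> linarith
  -- For `‖x‖ ≤ D` and `‖z‖ ≥ 1`, the point `x + T • z` has norm at least `D + 1`, hence lies where
  -- `φ` vanishes.
  set T : ℝ := 2 * D + 1
  set K : ENNReal := ∫⁻ t in Icc 0 T, ENNReal.ofReal (t ^ (-(finrank ℝ E : ℝ) / p))
  -- This is where `p` exceeding the dimension is used: the exponent is greater than -1.
  have hK : K ≠ ⊤ := by
    have h1 : IntervalIntegrable (fun t : ℝ => t ^ (-(finrank ℝ E : ℝ) / p)) volume 0 T :=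
      intervalIntegral.intervalIntegrable_rpow' (by
        rw [lt_div_iff₀ hp0]; linarith)
    rw [intervalIntegrable_iff_integrableOn_Icc_of_le (by positivity)] at h1
    exact (Integrable.lintegral_lt_top h1).ne
  set C : ENNReal := (μ A)⁻¹ * (3 * (K * μ A ^ (1 - 1 / p))) with hC
  have hCt : C ≠ ⊤ := by
    refine ENNReal.mul_ne_top (ENNReal.inv_ne_top.2 hA0) (ENNReal.mul_ne_top (by simp)
      (ENNReal.mul_ne_top hK (ENNReal.rpow_ne_top_of_nonneg ?_ hAt)))
    rw [sub_nonneg, div_le_one hp0]; linarith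
  refine ⟨C.toNNReal, fun φ hφ hsupp x => ?_⟩
  rw [ENNReal.coe_toNNReal hCt]
  by_cases hx : D < ‖x‖
  · simp [hsupp x hx]
  push Not at hx
  have hcont : Continuous (fderiv ℝ φ) := hφ.continuous_fderiv one_ne_zero
  set L := eLpNorm (fderiv ℝ φ) (ENNReal.ofReal p) μ
  have hray : ∀ z ∈ A, ‖φ x‖ₑ ≤ ∫⁻ t in Icc 0 T, 3 * ‖fderiv ℝ φ (x + t • z)‖ₑ := by
    intro z hzA
    have h0 : φ (x + T • z) = 0 := by
      apply hsupp
      have h1 := norm_sub_norm_le (T • z) (-x)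
      rw [norm_smul, norm_neg, sub_neg_eq_add, add_comm (T • z),
        Real.norm_of_nonneg (by positivity)] at h1
      have h2 : T * 1 ≤ T * ‖z‖ := by
        have := (hz z hzA).1
        gcongr
      have h3 : T = 2 * D + 1 := rfl
      linarith
    have hψ : ContDiff ℝ 1 (fun t : ℝ => φ (x + t • z)) := by fun_prop
    have h1 := enorm_sub_le_lintegral_deriv_of_contDiffOn_Icc (a := 0) (b := T)
      hψ.contDiffOn (by positivity)
    simp only [h0, zero_smul, add_zero, zero_sub, enorm_neg] at h1
    refine h1.trans (lintegral_mono fun t => ?_)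
    have h2 : HasDerivAt (fun t : ℝ => φ (x + t • z)) (fderiv ℝ φ (x + t • z) z) t := by
      have h3 : HasDerivAt (fun t : ℝ => x + t • z) z t := by
        simpa using ((hasDerivAt_id t).smul_const z).const_add x
      exact ((hφ.differentiable one_ne_zero) _).hasFDerivAt.comp_hasDerivAt t h3
    rw [h2.deriv]
    refine (ContinuousLinearMap.le_opENorm _ z).trans ?_
    rw [mul_comm]
    gcongr
    rw [← ofReal_norm]
    exact (ENNReal.ofReal_le_ofReal (hz z hzA).2).trans (by simp)
  -- Hölder on `A`, then the dilation `z ↦ x + t • z`, whose Jacobian produces the power of `t`.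
  have hslice : ∀ t : ℝ, 0 < t → ∫⁻ z in A, ‖fderiv ℝ φ (x + t • z)‖ₑ ∂μ
      ≤ ENNReal.ofReal (t ^ (-(finrank ℝ E : ℝ) / p)) * (L * μ A ^ (1 - 1 / p)) := by
    intro t ht
    rw [← eLpNorm_one_eq_lintegral_enorm]
    refine (eLpNorm_le_eLpNorm_mul_rpow_measure_univ (q := ENNReal.ofReal p)
      (by rw [ENNReal.one_le_ofReal]; linarith)
      (by fun_prop : Continuous fun z => fderiv ℝ φ (x + t • z)).aestronglyMeasurable).trans ?_
    rw [Measure.restrict_apply_univ, ENNReal.toReal_one, ENNReal.toReal_ofReal hp0.le, div_one,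
      ← mul_assoc, ← eLpNorm_comp_add_smul μ hcont.aestronglyMeasurable hp0 x ht]
    gcongr
    exact Measure.restrict_le_self
  have hmain : μ A * ‖φ x‖ₑ ≤ 3 * (K * μ A ^ (1 - 1 / p)) * L := by
    calc μ A * ‖φ x‖ₑ = ∫⁻ _ in A, ‖φ x‖ₑ ∂μ := by rw [setLIntegral_const, mul_comm]
      _ ≤ ∫⁻ z in A, (∫⁻ t in Icc 0 T, 3 * ‖fderiv ℝ φ (x + t • z)‖ₑ) ∂μ :=
        setLIntegral_mono' measurableSet_closedBall hray
      _ = ∫⁻ t in Icc 0 T, ∫⁻ z in A, 3 * ‖fderiv ℝ φ (x + t • z)‖ₑ ∂μ := by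
        apply lintegral_lintegral_swap
        apply Measurable.aemeasurable
        apply Continuous.measurable
        have h : Continuous fun q : E × ℝ => fderiv ℝ φ (x + q.2 • q.1) := by fun_prop
        exact ENNReal.continuous_const_mul (by simp) |>.comp h.enorm
      _ = ∫⁻ t in Icc 0 T, 3 * ∫⁻ z in A, ‖fderiv ℝ φ (x + t • z)‖ₑ ∂μ := by
        congr 1; ext t
        exact lintegral_const_mul' _ _ (by simp)
      _ ≤ ∫⁻ t in Icc 0 T, ENNReal.ofReal (t ^ (-(finrank ℝ E : ℝ) / p))
            * (3 * (L * μ A ^ (1 - 1 / p))) := by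
        rw [← restrict_Ioc_eq_restrict_Icc]
        refine setLIntegral_mono' measurableSet_Ioc fun t ht => ?_
        refine (mul_le_mul_right (hslice t ht.1) 3).trans_eq ?_
        ring
      _ = 3 * (K * μ A ^ (1 - 1 / p)) * L := by
        rw [lintegral_mul_const _ (by fun_prop)]
        ring
  calc ‖φ x‖ₑ = (μ A)⁻¹ * (μ A * ‖φ x‖ₑ) := by
        rw [← mul_assoc, ENNReal.inv_mul_cancel hA0 hAt, one_mul]
    _ ≤ (μ A)⁻¹ * (3 * (K * μ A ^ (1 - 1 / p)) * L) := by gcongr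
    _ = C * L := by rw [hC]; ring

/-! ### From test functions to `W_0^{1,p}` -/

lemma norm_gradient {F : Type*} [NormedAddCommGroup F] [InnerProductSpace ℝ F] [CompleteSpace F]
    (φ : F → ℝ) (x : F) : ‖gradient φ x‖ = ‖fderiv ℝ φ x‖ := by
  rw [gradient, LinearIsometryEquiv.norm_map]

namespace IsTestFunction

variable {N : ℕ} {Ω : Set (EuclideanSpace ℝ (Fin N))} {φ ψ : EuclideanSpace ℝ (Fin N) → ℝ}

lemma sub (hφ : IsTestFunction Ω φ) (hψ : IsTestFunction Ω ψ) :
    IsTestFunction Ω (fun x => φ x - ψ x) := by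
  refine ⟨hφ.1.sub hψ.1, hφ.2.1.sub hψ.2.1, ?_⟩
  exact (tsupport_sub φ ψ).trans (Set.union_subset hφ.2.2 hψ.2.2)

lemma differentiable (hφ : IsTestFunction Ω φ) : Differentiable ℝ φ :=
  hφ.1.differentiable (by simp)

lemma continuous_gradient (hφ : IsTestFunction Ω φ) : Continuous (gradient φ) :=
  (InnerProductSpace.toDual ℝ _).symm.continuous.comp (hφ.1.continuous_fderiv (by simp))

lemma gradient_sub (hφ : IsTestFunction Ω φ) (hψ : IsTestFunction Ω ψ)
    (x : EuclideanSpace ℝ (Fin N)) :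
    gradient (fun x => φ x - ψ x) x = gradient φ x - gradient ψ x := by
  simp only [gradient]
  rw [fderiv_fun_sub (hφ.differentiable x) (hψ.differentiable x), map_sub]

lemma eLpNorm_fderiv (hφ : IsTestFunction Ω φ) (p : ENNReal) :
    eLpNorm (fderiv ℝ φ) p volume = eLpNorm (gradient φ) p (volume.restrict Ω) := by
  rw [← eLpNorm_restrict_eq_of_support_subset (f := fderiv ℝ φ) (s := Ω)
    ((support_fderiv_subset ℝ).trans hφ.2.2)]
  exact eLpNorm_congr_norm_ae (.of_forall fun x => (norm_gradient φ x).symm)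

end IsTestFunction

/-- The sup-norm bound of test functions in a bounded domain by their gradients. -/
theorem exists_enorm_testFunction_le {N : ℕ} (hN : 1 ≤ N) {Ω : Set (EuclideanSpace ℝ (Fin N))}
    (hΩ : Bornology.IsBounded Ω) {p : ℝ} (hNp : (N : ℝ) < p) :
    ∃ C : NNReal, ∀ φ, IsTestFunction Ω φ → ∀ x,
      ‖φ x‖ₑ ≤ C * eLpNorm (gradient φ) (ENNReal.ofReal p) (volume.restrict Ω) := by
  have : NeZero N := ⟨by omega⟩
  obtain ⟨D, hD⟩ := hΩ.exists_norm_le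
  obtain ⟨C, hC⟩ := exists_enorm_le_mul_eLpNorm_fderiv
    (volume : Measure (EuclideanSpace ℝ (Fin N))) (p := p) (by simpa using hNp)
    (le_max_right D 0)
  refine ⟨C, fun φ hφ x => ?_⟩
  rw [← hφ.eLpNorm_fderiv]
  refine hC φ (hφ.1.of_le (by simp)) (fun y hy => ?_) x
  by_contra h
  have := hD y (hφ.2.2 (subset_tsupport φ h))
  exact absurd hy (not_lt.2 (this.trans (le_max_left _ _)))

open Filter Topology in
/-- For `p > N`, functions in `W_0^{1,p}` have continuous representatives, bounded by the `Lᵖ` norm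
of the gradient. -/
theorem exists_continuous_representative {N : ℕ} (hN : 1 ≤ N)
    {Ω : Set (EuclideanSpace ℝ (Fin N))} (hΩ : Bornology.IsBounded Ω) {p : ℝ}
    (hNp : (N : ℝ) < p) :
    ∃ C : NNReal, ∀ u Du, MemSobolevZero Ω p u Du → ∃ w : EuclideanSpace ℝ (Fin N) → ℝ,
      Continuous w ∧ (∀ᵐ x ∂(volume.restrict Ω), w x = u x) ∧
      ∀ x, ‖w x‖ₑ ≤ C * eLpNorm Du (ENNReal.ofReal p) (volume.restrict Ω) := by
  obtain ⟨C, hC⟩ := exists_enorm_testFunction_le hN hΩ hNp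
  refine ⟨C, fun u Du hu => ?_⟩
  have hN' : (1 : ℝ) ≤ N := by exact_mod_cast hN
  have hp1 : 1 ≤ ENNReal.ofReal p := by rw [ENNReal.one_le_ofReal]; linarith
  have hp0 : ENNReal.ofReal p ≠ 0 := (one_pos.trans_le hp1).ne'
  choose φ hφ hφu hφDu using fun n : ℕ => hu.approx (1 / ((n : ℝ) + 1)) (by positivity)
  set μ := volume.restrict Ω
  set ε : ℕ → ENNReal := fun n => ENNReal.ofReal (1 / ((n : ℝ) + 1))
  have hε : Tendsto ε atTop (𝓝 0) := by
    rw [← ENNReal.ofReal_zero]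
    exact ENNReal.tendsto_ofReal tendsto_one_div_add_atTop_nhds_zero_nat
  have hεanti : Antitone ε := fun m n h =>
    ENNReal.ofReal_le_ofReal (Nat.one_div_le_one_div h)
  have hDum := hu.memSobolev.memLp_grad.aestronglyMeasurable
  have hgm : ∀ n, AEStronglyMeasurable (gradient (φ n)) μ :=
    fun n => (hφ n).continuous_gradient.aestronglyMeasurable
  -- The sup bound applied to differences makes the approximating sequence uniformly Cauchy on the
  -- whole space.
  have hdiff : ∀ m n x, edist (φ m x) (φ n x) ≤ C * (ε m + ε n) := by
    intro m n x
    rw [edist_eq_enorm_sub]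
    refine (hC _ ((hφ m).sub (hφ n)) x).trans ?_
    gcongr
    have h1 : gradient (fun x => φ m x - φ n x)
        = (fun x => Du x - gradient (φ n) x) - fun x => Du x - gradient (φ m) x := by
      ext1 x
      rw [(hφ m).gradient_sub (hφ n)]
      simp
    rw [h1, add_comm]
    exact (eLpNorm_sub_le (hDum.sub (hgm n)) (hDum.sub (hgm m)) hp1).trans
      (add_le_add (hφDu n) (hφDu m))
  have hC2 : Tendsto (fun n => (C : ENNReal) * (2 * ε n)) atTop (𝓝 0) := by
    simpa using ENNReal.Tendsto.const_mul (ENNReal.Tendsto.const_mul hε (by simp))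
      (by simp) (a := (C : ENNReal))
  have hcauchy : ∀ δ > 0, ∃ n₀ : ℕ, ∀ m ≥ n₀, ∀ n ≥ n₀, ∀ x, edist (φ m x) (φ n x) < δ := by
    intro δ hδ
    obtain ⟨n₀, h⟩ := (hC2.eventually (gt_mem_nhds hδ)).exists
    refine ⟨n₀, fun m hm n hn x => lt_of_le_of_lt ((hdiff m n x).trans ?_) h⟩
    gcongr
    rw [two_mul]
    exact add_le_add (hεanti hm) (hεanti hn)
  have hlim : ∀ x, ∃ y, Tendsto (fun n => φ n x) atTop (𝓝 y) := fun x =>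
    cauchySeq_tendsto_of_complete (EMetric.cauchySeq_iff.2 fun δ hδ => by
      obtain ⟨n₀, h⟩ := hcauchy δ hδ
      exact ⟨n₀, fun m hm n hn => h m hm n hn x⟩)
  choose w hw using hlim
  have hunif : TendstoUniformly φ w atTop := by
    rw [← tendstoUniformlyOn_univ]
    refine UniformCauchySeqOn.tendstoUniformlyOn_of_tendsto ?_ fun x _ => hw x
    intro U hU
    obtain ⟨δ, hδ, hδU⟩ := mem_uniformity_edist.1 hU
    obtain ⟨n₀, h⟩ := hcauchy δ hδ
    rw [prod_atTop_atTop_eq]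
    filter_upwards [eventually_ge_atTop (n₀, n₀)] with m hm x _
    exact hδU (h m.1 hm.1 m.2 hm.2 x)
  refine ⟨w, hunif.continuous (Frequently.of_forall fun n => (hφ n).1.continuous), ?_, fun x => ?_⟩
  -- `Lᵖ` convergence yields an a.e. convergent subsequence, which identifies the uniform limit with
  -- `u`.
  · have h1 : TendstoInMeasure μ φ atTop u := by
      refine tendstoInMeasure_of_tendsto_eLpNorm hp0
        (fun n => (hφ n).1.continuous.aestronglyMeasurable)
        hu.memSobolev.memLp.aestronglyMeasurable ?_
      refine tendsto_of_tendsto_of_tendsto_of_le_of_le tendsto_const_nhds hε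
        (fun n => zero_le) fun n => ?_
      rw [eLpNorm_sub_comm]
      exact hφu n
    obtain ⟨ns, hns, hae⟩ := h1.exists_seq_tendsto_ae
    filter_upwards [hae] with x hx
    exact tendsto_nhds_unique ((hw x).comp hns.tendsto_atTop) hx
  · have h1 : ∀ n, ‖φ n x‖ₑ ≤ C * (eLpNorm Du (ENNReal.ofReal p) μ + ε n) := by
      intro n
      refine (hC _ (hφ n) x).trans ?_
      gcongr
      have h2 : gradient (φ n) = Du - fun x => Du x - gradient (φ n) x := by
        ext1 x; simp
      rw [h2]
      exact (eLpNorm_sub_le hDum (hDum.sub (hgm n)) hp1).trans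
        (add_le_add le_rfl (hφDu n))
    refine le_of_tendsto_of_tendsto' (hw x).enorm ?_ h1
    simpa using ENNReal.Tendsto.const_mul (hε.const_add (eLpNorm Du (ENNReal.ofReal p) μ))
      (a := (C : ENNReal)) (by simp)

/-! ### Lower-order powers and the nonlinearity -/

lemma exists_rpow_le_mul_rpow_add {s p ε : ℝ} (hs : 0 ≤ s) (hsp : s < p) (hε : 0 < ε) :
    ∃ A : ℝ, 0 ≤ A ∧ ∀ t : ℝ, 0 ≤ t → t ^ s ≤ ε * t ^ p + A := by
  -- The threshold where `ε t^p = t^s`; beyond it the `p`-th power dominates.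
  set t₀ : ℝ := ε ^ (-(1 / (p - s)))
  have hps : 0 < p - s := sub_pos.2 hsp
  have ht₀ : 0 < t₀ := Real.rpow_pos_of_pos hε _
  refine ⟨t₀ ^ s, by positivity, fun t ht => ?_⟩
  rcases le_total t t₀ with h | h
  · have h1 : t ^ s ≤ t₀ ^ s := Real.rpow_le_rpow ht h hs
    have h2 : 0 ≤ ε * t ^ p := by positivity
    linarith
  · have ht0 : 0 < t := ht₀.trans_le h
    have h1 : ε⁻¹ ≤ t ^ (p - s) := by
      have h2 : t₀ ^ (p - s) = ε⁻¹ := by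
        rw [← Real.rpow_mul hε.le, neg_mul, one_div_mul_cancel hps.ne', Real.rpow_neg_one]
      rw [← h2]
      exact Real.rpow_le_rpow ht₀.le h hps.le
    have h3 : t ^ p = t ^ s * t ^ (p - s) := by
      rw [← Real.rpow_add ht0, add_sub_cancel]
    have h4 : 1 ≤ ε * t ^ (p - s) := by
      rwa [inv_le_iff_one_le_mul₀' hε] at h1
    have h5 : 0 < t ^ s := by positivity
    have h6 : 0 < t₀ ^ s := by positivity
    rw [h3]
    nlinarith

/-- Composition with a Carathéodory function preserves measurability. -/
lemma IsCaratheodory.aemeasurable_comp {N : ℕ} {Ω : Set (EuclideanSpace ℝ (Fin N))}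
    {f : EuclideanSpace ℝ (Fin N) → ℝ → EuclideanSpace ℝ (Fin N) → ℝ} (hf : IsCaratheodory Ω f)
    {u : EuclideanSpace ℝ (Fin N) → ℝ} {Du : EuclideanSpace ℝ (Fin N) → EuclideanSpace ℝ (Fin N)}
    (hu : AEStronglyMeasurable u (volume.restrict Ω))
    (hDu : AEStronglyMeasurable Du (volume.restrict Ω)) :
    AEMeasurable (fun x => f x (u x) (Du x)) (volume.restrict Ω) := by
  obtain ⟨v, hv, hveq⟩ := hu.prodMk hDu
  -- Measurability in `x` is known only for frozen arguments, so it is first transferred to simple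
  -- functions; continuity in `(s, ξ)` then passes to the limit.
  have hsimple : ∀ s : SimpleFunc (EuclideanSpace ℝ (Fin N)) (ℝ × EuclideanSpace ℝ (Fin N)),
      AEMeasurable (fun x => f x (s x).1 (s x).2) (volume.restrict Ω) := by
    intro s
    have h1 : (fun x => f x (s x).1 (s x).2)
        = fun x => ∑ y ∈ s.range, (s ⁻¹' {y}).indicator (fun x => f x y.1 y.2) x := by
      ext x
      rw [Finset.sum_eq_single (s x)]
      · simp
      · intro y _ hy
        exact Set.indicator_of_notMem (fun h => hy h.symm) _
      · intro h
        exact absurd (s.mem_range_self x) h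
    rw [h1]
    exact Finset.aemeasurable_fun_sum _ fun y _ =>
      (hf.measurable y.1 y.2).indicator (s.measurableSet_fiber y)
  refine aemeasurable_of_tendsto_metrizable_ae Filter.atTop (fun n => hsimple (hv.approx n)) ?_
  filter_upwards [hf.continuous, hveq] with x hx hxv
  have h2 := (hx.tendsto (v x)).comp (hv.tendsto_approx x)
  rw [← hxv] at h2
  exact h2

/-- For bounded `u` each term of the growth bound is in `L¹`, as `Ω` has finite measure; the
remaining factor `u` is bounded. Integrability is needed to compare the Bochner integral with its
pointwise upper bound. -/
lemma integrable_caratheodory_mul {N : ℕ} {Ω : Set (EuclideanSpace ℝ (Fin N))}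
    (hΩ : Bornology.IsBounded Ω) {p S : ℝ} (hp : 1 < p)
    {f : EuclideanSpace ℝ (Fin N) → ℝ → EuclideanSpace ℝ (Fin N) → ℝ}
    (hf : IsCaratheodory Ω f) (hf_growth : GrowthCondition Ω p f)
    {u : EuclideanSpace ℝ (Fin N) → ℝ} {Du : EuclideanSpace ℝ (Fin N) → EuclideanSpace ℝ (Fin N)}
    (hu : AEStronglyMeasurable u (volume.restrict Ω))
    (hDu : MemLp Du (ENNReal.ofReal p) (volume.restrict Ω))
    (huS : ∀ᵐ x ∂(volume.restrict Ω), |u x| ≤ S) :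
    Integrable (fun x => f x (u x) (Du x) * u x) (volume.restrict Ω) := by
  have : IsFiniteMeasure (volume.restrict Ω) := ⟨by simpa using hΩ.measure_lt_top⟩
  obtain ⟨σ, b, c, r₁, r₂, hb, hc, hr₁, hr₂, -, hσ, hle⟩ := hf_growth
  have hσint : Integrable σ (volume.restrict Ω) :=
    hσ.integrable (by rwa [ENNReal.one_le_ofReal])
  have hDint : Integrable (fun x => ‖Du x‖ ^ (p - 1)) (volume.restrict Ω) := by
    have h := (hDu.mono_exponent (ENNReal.ofReal_le_ofReal
      (by linarith : p - 1 ≤ p))).integrable_norm_rpow (by simpa using hp) (by simp)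
    rwa [ENNReal.toReal_ofReal (by linarith)] at h
  refine Integrable.mul_bdd (c := S) ?_ hu huS
  refine Integrable.mono' ((hσint.add (integrable_const (b * S ^ r₂))).add (hDint.const_mul c))
    (hf.aemeasurable_comp hu hDu.aestronglyMeasurable).aestronglyMeasurable ?_
  filter_upwards [hle, huS] with x hx hux
  refine (hx _ _).trans ?_
  simp only [Pi.add_apply]
  gcongr

/-! ### Energy estimate and conclusion -/

lemma inner_rpow_smul_self {F : Type*} [NormedAddCommGroup F] [InnerProductSpace ℝ F] {r : ℝ}
    (hr : 0 < r) (ξ : F) : inner ℝ (‖ξ‖ ^ (r - 2) • ξ) ξ = ‖ξ‖ ^ r := by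
  rw [real_inner_smul_left, real_inner_self_eq_norm_sq]
  rcases (norm_nonneg ξ).eq_or_lt with h | h
  · rw [← h, Real.zero_rpow hr.ne']; simp
  · rw [← Real.rpow_natCast, ← Real.rpow_add h]
    norm_num

/-- The energy estimate, obtained by testing the equation with the solution itself. -/
lemma IsWeakSolution.mul_integral_le {N : ℕ} {Ω : Set (EuclideanSpace ℝ (Fin N))}
    (hΩ : Bornology.IsBounded Ω) {p q a₀ c₀ c₁ ε δ A B S : ℝ} (hq : 1 < q) (hqp : q < p)
    {g : ℝ → ℝ} (hg : WeightCondition a₀ g)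
    {f : EuclideanSpace ℝ (Fin N) → ℝ → EuclideanSpace ℝ (Fin N) → ℝ} {α : ℝ}
    (hc₁ : 0 < c₁) (hδ : 0 ≤ δ)
    (hf_car : IsCaratheodory Ω f) (hf_growth : GrowthCondition Ω p f)
    (hf : ∀ᵐ x ∂(volume.restrict Ω), ∀ (s : ℝ) (ξ : EuclideanSpace ℝ (Fin N)),
      f x s ξ * s ≤ c₀ * ‖ξ‖ ^ p + c₁ * (|s| ^ α + 1))
    (hqA : ∀ t : ℝ, 0 ≤ t → t ^ q ≤ ε * t ^ p + A)
    (hαB : ∀ t : ℝ, 0 ≤ t → t ^ α ≤ δ * t ^ p + B)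
    {u : EuclideanSpace ℝ (Fin N) → ℝ} {Du : EuclideanSpace ℝ (Fin N) → EuclideanSpace ℝ (Fin N)}
    (hu : IsWeakSolution Ω p q g f u Du)
    (huS : ∀ᵐ x ∂(volume.restrict Ω), |u x| ≤ S) :
    a₀ * ∫ x in Ω, ‖Du x‖ ^ p ≤ (ε + c₀) * (∫ x in Ω, ‖Du x‖ ^ p)
      + (A + c₁ * (δ * S ^ p + B + 1)) * (volume Ω).toReal := by
  have : IsFiniteMeasure (volume.restrict Ω) := ⟨by simpa using hΩ.measure_lt_top⟩
  have hp : 0 < p := by linarith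
  have hintp : Integrable (fun x => ‖Du x‖ ^ p) (volume.restrict Ω) := by
    have h := hu.mem.memSobolev.memLp_grad.integrable_norm_rpow (by simpa using hp) (by simp)
    rwa [ENNReal.toReal_ofReal hp.le] at h
  have hintq : Integrable (fun x => ‖Du x‖ ^ q) (volume.restrict Ω) := by
    have h := (hu.mem.memSobolev.memLp_grad.mono_exponent
      (ENNReal.ofReal_le_ofReal hqp.le)).integrable_norm_rpow
      (by simpa using one_pos.trans hq) (by simp)
    rwa [ENNReal.toReal_ofReal (by linarith)] at h
  -- No upper bound on `g` is assumed; continuity on the compact range of `u` supplies one.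
  obtain ⟨G, hG⟩ := (isCompact_Icc (a := -S) (b := S)).exists_bound_of_continuousOn
    hg.continuous.continuousOn
  have hintg : Integrable (fun x => g (u x) * ‖Du x‖ ^ p) (volume.restrict Ω) := by
    refine hintp.bdd_mul (c := G)
      (hg.continuous.comp_aestronglyMeasurable hu.mem.memSobolev.memLp.aestronglyMeasurable) ?_
    filter_upwards [huS] with x hx
    exact hG _ (abs_le.1 hx)
  have heq := hu.eq u Du hu.mem
  simp only [inner_rpow_smul_self hp, inner_rpow_smul_self (one_pos.trans hq)] at heq
  have h1 : a₀ * ∫ x in Ω, ‖Du x‖ ^ p ≤ ∫ x in Ω, g (u x) * ‖Du x‖ ^ p := by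
    rw [← integral_const_mul]
    refine integral_mono (hintp.const_mul _) hintg fun x => ?_
    have := hg.le (u x)
    dsimp only
    gcongr
  have h2 : ∫ x in Ω, ‖Du x‖ ^ q
      ≤ ε * (∫ x in Ω, ‖Du x‖ ^ p) + A * (volume Ω).toReal := by
    refine (integral_mono hintq ((hintp.const_mul ε).add (integrable_const A))
      fun x => hqA _ (norm_nonneg _)).trans_eq ?_
    rw [integral_add' (hintp.const_mul ε) (integrable_const A), integral_const_mul,
      integral_const, smul_eq_mul, measureReal_restrict_apply_univ, measureReal_def, mul_comm A]
  set B' := c₁ * (δ * S ^ p + B + 1)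
  have h3 : ∫ x in Ω, (c₀ * ‖Du x‖ ^ p + B')
      = c₀ * (∫ x in Ω, ‖Du x‖ ^ p) + B' * (volume Ω).toReal := by
    rw [integral_add (hintp.const_mul c₀) (integrable_const B'), integral_const_mul,
      integral_const, smul_eq_mul, measureReal_restrict_apply_univ, measureReal_def, mul_comm B']
  have h4 : ∫ x in Ω, f x (u x) (Du x) * u x ≤ ∫ x in Ω, (c₀ * ‖Du x‖ ^ p + B') := by
    refine integral_mono_ae (integrable_caratheodory_mul hΩ (hq.trans hqp) hf_car hf_growth
      hu.mem.memSobolev.memLp.aestronglyMeasurable hu.mem.memSobolev.memLp_grad huS)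
      ((hintp.const_mul c₀).add (integrable_const B')) ?_
    filter_upwards [hf, huS] with x hfx hux
    refine (hfx _ _).trans ?_
    have h5 := hαB _ (abs_nonneg (u x))
    have h6 : |u x| ^ p ≤ S ^ p := Real.rpow_le_rpow (abs_nonneg _) hux hp.le
    have h7 : |u x| ^ α ≤ δ * S ^ p + B := h5.trans (by gcongr)
    simp only [B']
    gcongr
  rw [h3] at h4
  linarith

theorem mainTheorem5 (N : ℕ) (hN : 1 ≤ N) (Ω : Set (EuclideanSpace ℝ (Fin N)))
    (hΩ_open : IsOpen Ω) (hΩ_conn : IsConnected Ω) (hΩ_bdd : Bornology.IsBounded Ω)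
    (p q : ℝ) (hq : 1 < q) (hqp : q < p) (hNp : (N : ℝ) < p)
    (a₀ : ℝ) (g : ℝ → ℝ) (hg : WeightCondition a₀ g)
    (f : EuclideanSpace ℝ (Fin N) → ℝ → EuclideanSpace ℝ (Fin N) → ℝ)
    (hf : IsCaratheodory Ω f) (hf_growth : GrowthCondition Ω p f)
    (hf_onesided : OneSidedCondition Ω p a₀ f) :
    ∃ R R₁ : ℝ, 0 < R ∧ 0 < R₁ ∧
      ∀ (u : EuclideanSpace ℝ (Fin N) → ℝ)
        (Du : EuclideanSpace ℝ (Fin N) → EuclideanSpace ℝ (Fin N)),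
        IsWeakSolution Ω p q g f u Du →
          eLpNorm Du (ENNReal.ofReal p) (volume.restrict Ω) ≤ ENNReal.ofReal R₁ ∧
          ∃ w : EuclideanSpace ℝ (Fin N) → ℝ, ContinuousOn w (closure Ω) ∧
            (∀ᵐ x ∂(volume.restrict Ω), w x = u x) ∧ ∀ x ∈ closure Ω, |w x| ≤ R := by
  have hp : 0 < p := by linarith
  obtain ⟨C, hC⟩ := exists_continuous_representative hN hΩ_bdd hNp
  obtain ⟨c₀, c₁, α, hc₀, hc₁, hα, hαp, hfle⟩ := hf_onesided
  have hκ : 0 < a₀ - c₀ := sub_pos.2 hc₀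
  set κ := a₀ - c₀ with hκdef
  set V := (volume Ω).toReal
  have hV : 0 ≤ V := ENNReal.toReal_nonneg
  set K := c₁ * (C : ℝ) ^ p * V
  have hK : 0 ≤ K := by positivity
  -- Chosen so that the `|u|^α` term costs at most `κ / 4 * I`; the `+ 1` covers `K = 0`. The
  -- `q`-term costs another `κ / 4 * I`, leaving `κ / 2 * I ≤ M`.
  set δ := κ / (4 * (K + 1)) with hδdef
  have hδ : 0 < δ := by positivity
  have hδK : δ * K ≤ κ / 4 := by
    rw [hδdef, div_mul_eq_mul_div, div_le_div_iff₀ (by positivity) (by positivity)]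
    nlinarith
  obtain ⟨A, hA, hqA⟩ := exists_rpow_le_mul_rpow_add (by linarith) hqp
    (show 0 < κ / 4 by positivity)
  obtain ⟨B, hB, hαB⟩ := exists_rpow_le_mul_rpow_add (by linarith) hαp hδ
  set M := (A + c₁ * (B + 1)) * V with hM
  set R₁ := (2 * M / κ) ^ (1 / p) + 1
  have hR₁ : 0 < R₁ := by positivity
  refine ⟨C * R₁ + 1, R₁, by positivity, hR₁, fun u Du hu => ?_⟩
  obtain ⟨w, hwc, hwu, hw⟩ := hC u Du hu.mem
  set I := ∫ x in Ω, ‖Du x‖ ^ p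
  have hI0 : 0 ≤ I := integral_nonneg fun x => by positivity
  have hnorm : eLpNorm Du (ENNReal.ofReal p) (volume.restrict Ω)
      = ENNReal.ofReal (I ^ (1 / p)) := by
    rw [hu.mem.memSobolev.memLp_grad.eLpNorm_eq_integral_rpow_norm (by simpa using hp) (by simp),
      ENNReal.toReal_ofReal hp.le, one_div]
  have hwI : ∀ x, |w x| ≤ C * I ^ (1 / p) := by
    intro x
    have h := hw x
    rw [hnorm, ← ENNReal.ofReal_coe_nnreal, ← ENNReal.ofReal_mul C.coe_nonneg,
      Real.enorm_eq_ofReal_abs, ENNReal.ofReal_le_ofReal_iff (by positivity)] at h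
    exact h
  have hI : I ≤ 2 * M / κ := by
    -- Here `S` is the solution-dependent bound `C * I ^ (1 / p)`, so `S ^ p` is linear in `I` and
    -- can be absorbed.
    have h1 := hu.mul_integral_le hΩ_bdd hq hqp hg hc₁ hδ.le hf hf_growth hfle hqA hαB
      (hwu.mono fun x hx => hx ▸ hwI x)
    have h2 : ((C : ℝ) * I ^ (1 / p)) ^ p = (C : ℝ) ^ p * I := by
      rw [Real.mul_rpow C.coe_nonneg (by positivity), ← Real.rpow_mul hI0,
        one_div_mul_cancel hp.ne', Real.rpow_one]
    rw [h2] at h1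
    have h3 : δ * K * I ≤ κ / 4 * I := by gcongr
    have h4 : (A + c₁ * (δ * ((C : ℝ) ^ p * I) + B + 1)) * V = M + δ * K * I := by
      simp only [hM, K]; ring
    rw [le_div_iff₀ hκ]
    change a₀ * I ≤ (κ / 4 + c₀) * I + _ * V at h1
    rw [h4] at h1
    have h5 : κ * I = a₀ * I - c₀ * I := by rw [hκdef]; ring
    linarith
  have hIR : I ^ (1 / p) ≤ R₁ :=
    (Real.rpow_le_rpow hI0 hI (by positivity)).trans (by simp [R₁])
  refine ⟨hnorm ▸ ENNReal.ofReal_le_ofReal hIR, w, hwc.continuousOn, hwu, fun x _ => ?_⟩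
  have : (C : ℝ) * I ^ (1 / p) ≤ C * R₁ := by gcongr
  linarith [hwI x]
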